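/- All systems $A,B,\dots$ are finite-dimensional nonzero complex Hilbert spaces, $|A|$ is the dimension of $A$, $\mathrm{CPTP}(A\to B)$ is the set of quantum channels (completely positive trace-preserving linear maps) from operators on $A$ to operators on $B$, and $\log=\log_2$. The uniform channel is $\mathcal R=\mathcal R^{A\to B}:X\mapsto \mathrm{Tr}[X]\,I_B/|B|$. A superchannel $\Theta$ is a linear map on superoperators of the form $\Theta[\mathcal N^{A\to B}]=\mathcal E^{RB\to B}\circ(\mathsf{id}_R\otimes\mathcal N^{A\to B})\circ\mathcal V^{A'\to RA}$ with an auxiliary system $R$, an isometry channel $\mathcal V$ and a channel $\mathcal E$; it is in standard form if $|R|$ is minimal among all such representations of $\Theta$. $\Theta$ is mixing if, in standard form, $\mathcal E$ is conditionally unital, i.e. $\omega\mapsto\mathcal E(\tau^R\otimes\omega)$ is unital for every density matrix $\tau$ on $R$. For $\mathcal N\in\mathrm{CPTP}(A\to B)$ and $\mathcal M\in\mathrm{CPTP}(A'\to B)$, $\mathcal N\succ\mathcal M$ means that $\mathcal M=\Theta[\mathcal N]$ for some mixing superchannel $\Theta$. For $\mathcal M\in\mathrm{CPTP}(A'\to B')$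 in general, $\mathcal N\succ\mathcal M$ means: if $|B|>|B'|$, that $\mathcal N\succ\mathcal U\circ\mathcal M$ for some isometry channel $\mathcal U^{B'\to B}$; if $|B|\le|B'|$, that $\mathcal V\circ\mathcal N\succ\mathcal M$ for some isometry channel $\mathcal V^{B\to B'}$. A channel entropy is a function $\mathbb H$, not identically zero, that assigns a real number $\mathbb H(B|A)_{\mathcal N}$ to every channel $\mathcal N\in\mathrm{CPTP}(A\to B)$, for all systems $A,B$, such that (1) $\mathcal N^{A\to B}\succ\mathcal M^{A'\to B'}$ implies $\mathbb H(B|A)_{\mathcal N}\le\mathbb H(B'|A')_{\mathcal M}$, and (2) $\mathbb H(BB'|AA')_{\mathcal N\otimes\mathcal M}=\mathbb H(B|A)_{\mathcal N}+\mathbb H(B'|A')_{\mathcal M}$. It is normalized if the uniform qubit state (as a channel with one-dimensional input) has entropy $1$. The min-entropy of a channel is $$H_{\min}(B|A)_{\mathcal N}=\log|B|-D_{\max}(\mathcal N\|\mathcal R),\qquad D_{\max}(\mathcal N\|\mathcal R)=\min\{\log t: t>0,\ t\mathcal R-\mathcal N\text{ is completely positive}\}.$$ **Theorem.** Every normalized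 channel entropy $\mathbb H$ satisfies $$\mathbb H(B|A)_{\mathcal N}\ \ge\ H_{\min}(B|A)_{\mathcal N}$$ for all systems $A,B$ and all $\mathcal N\in\mathrm{CPTP}(A\to B)$. Moreover $H_{\min}$ is itself a normalized channel entropy; thus it is the smallest normalized channel entropy. -/

import Mathlib

open scoped Kronecker ComplexOrder

noncomputable section

namespace QChannel

/-!
Finite-dimensional quantum systems are represented by finite nonempty types `A`, `B`, … (an
orthonormal basis of the underlying Hilbert space), operators on `A` by complex matrices indexed by
`A`, and the composite of two systems by the product type.
-/

/-- Superoperators from system `A` to system `B`: complex linear maps on matrices. -/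
abbrev Superop (A B : Type) : Type := Matrix A A ℂ →ₗ[ℂ] Matrix B B ℂ

/-- `id ⊗ Φ`, with the reference system `K` on the left: `Φ` is applied to each block. -/
def lTensor (K : Type) {A B : Type} (Φ : Superop A B) : Superop (K × A) (K × B) where
  toFun X := Matrix.of fun p q => Φ (Matrix.of fun a a' => X (p.1, a) (q.1, a')) p.2 q.2
  map_add' X Y := by
    ext p q
    exact congrFun (congrFun (map_add Φ (Matrix.of fun a a' => X (p.1, a) (q.1, a'))
      (Matrix.of fun a a' => Y (p.1, a) (q.1, a'))) p.2) q.2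
  map_smul' c X := by
    ext p q
    exact congrFun (congrFun (map_smul Φ c (Matrix.of fun a a' => X (p.1, a) (q.1, a'))) p.2) q.2

/-- `Φ ⊗ id`, with the reference system `K` on the right. -/
def rTensor (K : Type) {A B : Type} (Φ : Superop A B) : Superop (A × K) (B × K) where
  toFun X := Matrix.of fun p q => Φ (Matrix.of fun a a' => X (a, p.2) (a', q.2)) p.1 q.1
  map_add' X Y := by
    ext p q
    exact congrFun (congrFun (map_add Φ (Matrix.of fun a a' => X (a, p.2) (a', q.2))
      (Matrix.of fun a a' => Y (a, p.2) (a', q.2))) p.1) q.1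
  map_smul' c X := by
    ext p q
    exact congrFun (congrFun (map_smul Φ c (Matrix.of fun a a' => X (a, p.2) (a', q.2))) p.1) q.1

/-- The tensor product `Φ ⊗ Ψ = (Φ ⊗ id) ∘ (id ⊗ Ψ)` of two superoperators. -/
def tensor {A B A' B' : Type} (Φ : Superop A B) (Ψ : Superop A' B') :
    Superop (A × A') (B × B') :=
  rTensor B' Φ ∘ₗ lTensor A Ψ

/-- The tensor product acts on product operators as expected. -/
theorem tensor_kronecker {A B A' B' : Type} (Φ : Superop A B) (Ψ : Superop A' B')
    (X : Matrix A A ℂ) (Y : Matrix A' A' ℂ) : tensor Φ Ψ (X ⊗ₖ Y) = Φ X ⊗ₖ Ψ Y := by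
  have h1 : lTensor A Ψ (X ⊗ₖ Y) = X ⊗ₖ Ψ Y := by
    ext p q
    exact congrFun (congrFun (map_smul Ψ (X p.1 q.1) Y) p.2) q.2
  have h2 : rTensor B' Φ (X ⊗ₖ Ψ Y) = Φ X ⊗ₖ Ψ Y := by
    ext p q
    have h3 : (Matrix.of fun a a' => X a a' * Ψ Y p.2 q.2) = (Ψ Y p.2 q.2) • X := by
      ext a a'
      simp [mul_comm]
    simp [rTensor, h3, mul_comm]
  simp [tensor, h1, h2]

/-- Complete positivity: `id ⊗ Φ` preserves positive semidefiniteness for every finite reference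
system `K`. -/
def IsCP {A B : Type} (Φ : Superop A B) : Prop :=
  ∀ (K : Type) [Finite K] (X : Matrix (K × A) (K × A) ℂ),
    X.PosSemidef → (lTensor K Φ X).PosSemidef

/-- Trace preservation. -/
def IsTP {A B : Type} [Fintype A] [Fintype B] (Φ : Superop A B) : Prop :=
  ∀ X, (Φ X).trace = X.trace

/-- Quantum channels, CPTP(A → B). -/
def Channel (A B : Type) [Fintype A] [Fintype B] : Type :=
  {Φ : Superop A B // IsCP Φ ∧ IsTP Φ}

theorem isCP_lTensor {A B : Type} (L : Type) [Finite L] {Φ : Superop A B} (h : IsCP Φ) :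
    IsCP (lTensor L Φ) := by
  intro K _ X hX
  have h1 := h (K × L) _ (hX.submatrix (fun p : (K × L) × A => (p.1.1, (p.1.2, p.2))))
  exact h1.submatrix (fun p : K × (L × B) => ((p.1, p.2.1), p.2.2))

theorem isCP_rTensor {A B : Type} (L : Type) [Finite L] {Φ : Superop A B} (h : IsCP Φ) :
    IsCP (rTensor L Φ) := by
  intro K _ X hX
  have h1 := h (K × L) _ (hX.submatrix (fun p : (K × L) × A => (p.1.1, (p.2, p.1.2))))
  exact h1.submatrix (fun p : K × (B × L) => ((p.1, p.2.2), p.2.1))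

theorem isCP_comp {A B C : Type} {Φ : Superop B C} {Ψ : Superop A B} (h : IsCP Φ) (h' : IsCP Ψ) :
    IsCP (Φ ∘ₗ Ψ) := fun K _ X hX => h K _ (h' K X hX)

theorem isTP_lTensor {A B : Type} [Fintype A] [Fintype B] (L : Type) [Fintype L]
    {Φ : Superop A B} (h : IsTP Φ) : IsTP (lTensor L Φ) := by
  intro X
  simp only [Matrix.trace, Fintype.sum_prod_type]
  exact Finset.sum_congr rfl fun l _ => h (Matrix.of fun a a' => X (l, a) (l, a'))

theorem isTP_rTensor {A B : Type} [Fintype A] [Fintype B] (L : Type) [Fintype L]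
    {Φ : Superop A B} (h : IsTP Φ) : IsTP (rTensor L Φ) := by
  intro X
  simp only [Matrix.trace, Fintype.sum_prod_type_right]
  exact Finset.sum_congr rfl fun l _ => h (Matrix.of fun a a' => X (a, l) (a', l))

/-- The tensor product `𝒩 ⊗ ℳ` of two channels. -/
def Channel.tensor {A B A' B' : Type} [Fintype A] [Fintype B] [Fintype A'] [Fintype B']
    (N : Channel A B) (M : Channel A' B') : Channel (A × A') (B × B') :=
  ⟨QChannel.tensor N.1 M.1,
    isCP_comp (isCP_rTensor B' N.2.1) (isCP_lTensor A M.2.1),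
    fun X => (isTP_rTensor B' N.2.2 _).trans (isTP_lTensor A M.2.2 X)⟩

/-- The map `X ↦ Tr[X] · 1/|B|`. -/
def uniformSuperop (A B : Type) [Fintype A] [Fintype B] [DecidableEq B] : Superop A B where
  toFun X := (X.trace / (Fintype.card B : ℂ)) • (1 : Matrix B B ℂ)
  map_add' X Y := by simp [add_div, add_smul]
  map_smul' c X := by simp [mul_div_assoc, smul_smul]

theorem isCP_uniformSuperop (A B : Type) [Fintype A] [Fintype B] [DecidableEq B] :
    IsCP (uniformSuperop A B) := by
  classical
  intro K _ X hX
  have := Fintype.ofFinite K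
  have h1 : (∑ a : A, X.submatrix (fun k : K => (k, a)) (fun k : K => (k, a))).PosSemidef :=
    Matrix.posSemidef_sum _ fun a _ => hX.submatrix _
  have h2 : ((1 / (Fintype.card B : ℂ)) • (1 : Matrix B B ℂ)).PosSemidef :=
    Matrix.PosSemidef.one.smul (by positivity)
  suffices e : lTensor K (uniformSuperop A B) X = (∑ a : A, X.submatrix (fun k : K => (k, a))
      (fun k : K => (k, a))) ⊗ₖ ((1 / (Fintype.card B : ℂ)) • (1 : Matrix B B ℂ)) by
    rw [e]
    exact h1.kronecker h2
  ext p q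
  simp [lTensor, uniformSuperop, Matrix.kroneckerMap_apply, Matrix.trace, Matrix.sum_apply,
    div_eq_mul_inv, mul_assoc]

/-- The uniform (completely randomizing) channel `ℛ^{A → B}`, which outputs the maximally mixed
state of `B` for every input state. For a one-dimensional `A` it is the uniform state of `B`. -/
def uniformChannel (A B : Type) [Fintype A] [Fintype B] [DecidableEq B] [Nonempty B] :
    Channel A B :=
  ⟨uniformSuperop A B, isCP_uniformSuperop A B, fun X => by
    simp [uniformSuperop, Matrix.trace_smul, Matrix.trace_one]⟩

/-- Conjugation `X ↦ V X Vᴴ`; an isometry channel if `Vᴴ V = 1`. -/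
def conjBy {A B : Type} [Fintype A] (V : Matrix B A ℂ) : Superop A B where
  toFun X := V * X * V.conjTranspose
  map_add' X Y := by rw [Matrix.mul_add, Matrix.add_mul]
  map_smul' c X := by simp

/-- `V` is (the matrix of) an isometry. -/
def IsIsometry {A B : Type} [DecidableEq A] [Fintype B] (V : Matrix B A ℂ) : Prop :=
  V.conjTranspose * V = 1

/-- Density matrices (states) of the system `R`. -/
def IsState {R : Type} [Fintype R] (τ : Matrix R R ℂ) : Prop :=
  τ.PosSemidef ∧ τ.trace = 1

/-- A channel `E` from `RB` to `B` is conditionally unital if for every state `τ` of `R` the channel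
`ω ↦ E (τ ⊗ ω)` is unital, hence doubly stochastic. -/
def IsConditionallyUnital {R B : Type} [Fintype R] [DecidableEq B] (E : Superop (R × B) B) : Prop :=
  ∀ τ : Matrix R R ℂ, IsState τ → E (τ ⊗ₖ (1 : Matrix B B ℂ)) = 1

/-- The supermap `Θ` is the superchannel implemented by the auxiliary system `R`, the pre-processing
isometry `V : A' → RA` and the post-processing channel `E : RB → B`, that is,
`Θ[𝒩] = E ∘ (id_R ⊗ 𝒩) ∘ (V · Vᴴ)`. -/
structure IsRealization {A A' B : Type} [Fintype A] [Fintype A'] [DecidableEq A'] [Fintype B]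
    (Θ : Superop A B →ₗ[ℂ] Superop A' B) (R : Type) [Fintype R]
    (V : Matrix (R × A) A' ℂ) (E : Superop (R × B) B) : Prop where
  isometry : IsIsometry V
  channel : IsCP E ∧ IsTP E
  action : ∀ N : Superop A B, Θ N = E ∘ₗ lTensor R N ∘ₗ conjBy V

/-- A realization is in standard form if its auxiliary system has the least possible dimension. -/
structure IsStandardForm {A A' B : Type} [Fintype A] [Fintype A'] [DecidableEq A'] [Fintype B]
    (Θ : Superop A B →ₗ[ℂ] Superop A' B) (R : Type) [Fintype R]
    (V : Matrix (R × A) A' ℂ) (E : Superop (R × B) B) : Prop where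
  realization : IsRealization Θ R V E
  minimal : ∀ (R' : Type) [Fintype R'] (V' : Matrix (R' × A) A' ℂ) (E' : Superop (R' × B) B),
    IsRealization Θ R' V' E' → Fintype.card R ≤ Fintype.card R'

/-- Mixing superchannels: in standard form the post-processing is conditionally unital. -/
def IsMixing {A A' B : Type} [Fintype A] [Fintype A'] [DecidableEq A'] [Fintype B] [DecidableEq B]
    (Θ : Superop A B →ₗ[ℂ] Superop A' B) : Prop :=
  ∃ (R : Type) (_ : Fintype R) (V : Matrix (R × A) A' ℂ) (E : Superop (R × B) B),
    IsStandardForm Θ R V E ∧ IsConditionallyUnital E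

/-- Channel majorization for two channels with the same output system. -/
def MajorizesSame {A A' B : Type} [Fintype A] [Fintype A'] [DecidableEq A'] [Fintype B]
    [DecidableEq B] (N : Superop A B) (M : Superop A' B) : Prop :=
  ∃ Θ : Superop A B →ₗ[ℂ] Superop A' B, IsMixing Θ ∧ M = Θ N

/-- Channel majorization `𝒩 ≻ ℳ` for arbitrary output systems: the smaller output system is embedded
in the larger one by an isometry. -/
def Majorizes {A B A' B' : Type} [Fintype A] [Fintype B] [DecidableEq B]
    [Fintype A'] [DecidableEq A'] [Fintype B'] [DecidableEq B']
    (N : Channel A B) (M : Channel A' B') : Prop :=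
  (Fintype.card B' < Fintype.card B ∧
    ∃ U : Matrix B B' ℂ, IsIsometry U ∧ MajorizesSame N.1 (conjBy U ∘ₗ M.1)) ∨
  (Fintype.card B ≤ Fintype.card B' ∧
    ∃ V : Matrix B' B ℂ, IsIsometry V ∧ MajorizesSame (conjBy V ∘ₗ N.1) M.1)

/-- Real-valued functions on all channels between finite-dimensional systems. -/
abbrev ChannelFunction : Type 1 :=
  ∀ (A B : Type) [Fintype A] [DecidableEq A] [Nonempty A] [Fintype B] [DecidableEq B] [Nonempty B],
    Channel A B → ℝ

/-- Channel entropies: functions on channels that are not identically zero, monotone under channel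
majorization and additive under tensor products. -/
structure IsChannelEntropy (H : ChannelFunction) : Prop where
  nonzero : ∃ (A B : Type) (_ : Fintype A) (_ : DecidableEq A) (_ : Nonempty A)
    (_ : Fintype B) (_ : DecidableEq B) (_ : Nonempty B) (N : Channel A B), H A B N ≠ 0
  monotone : ∀ (A B A' B' : Type) [Fintype A] [DecidableEq A] [Nonempty A]
    [Fintype B] [DecidableEq B] [Nonempty B] [Fintype A'] [DecidableEq A'] [Nonempty A']
    [Fintype B'] [DecidableEq B'] [Nonempty B'] (N : Channel A B) (M : Channel A' B'),
    Majorizes N M → H A B N ≤ H A' B' M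
  additive : ∀ (A B A' B' : Type) [Fintype A] [DecidableEq A] [Nonempty A]
    [Fintype B] [DecidableEq B] [Nonempty B] [Fintype A'] [DecidableEq A'] [Nonempty A']
    [Fintype B'] [DecidableEq B'] [Nonempty B'] (N : Channel A B) (M : Channel A' B'),
    H (A × A') (B × B') (N.tensor M) = H A B N + H A' B' M

/-- Normalization: the uniform qubit state has unit entropy. -/
def IsNormalized (H : ChannelFunction) : Prop :=
  H Unit (Fin 2) (uniformChannel Unit (Fin 2)) = 1

/-- The numbers `log₂ t` with `t ℳ ≥ 𝒩` in the order given by the cone of completely positive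
maps. -/
def dmaxSet {A B : Type} [Fintype A] [Fintype B] (N M : Channel A B) : Set ℝ :=
  {x | ∃ t : ℝ, 0 < t ∧ IsCP ((t : ℂ) • M.1 - N.1) ∧ x = Real.logb 2 t}

/-- The max-relative entropy `D_max(𝒩‖ℳ) = min {log₂ t : t ℳ ≥ 𝒩}` of channels, for pairs for
which such a `t` exists; for the uniform channel `ℳ = ℛ` see `isLeast_dmax_uniform`. -/
def dmax {A B : Type} [Fintype A] [Fintype B] (N M : Channel A B) : ℝ :=
  sInf (dmaxSet N M)

theorem posSemidef_partialTrace_sub {K B : Type} [Finite K] [Fintype B] [DecidableEq B]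
    {Y : Matrix (K × B) (K × B) ℂ} (hY : Y.PosSemidef) :
    (Matrix.of fun p q : K × B =>
      (Fintype.card B : ℂ) * (if p.2 = q.2 then ∑ b, Y (p.1, b) (q.1, b) else 0)
        - Y p q).PosSemidef := by
  classical
  have := Fintype.ofFinite K
  have h1 : ∀ d : K × B → ℝ, (Matrix.of fun p q => (d p : ℂ) * Y p q * (d q : ℂ)).PosSemidef := by
    intro d
    have h := hY.mul_mul_conjTranspose_same (Matrix.diagonal fun p => (d p : ℂ))
    convert h using 1
    ext p q
    simp [Matrix.diagonal_conjTranspose, Matrix.mul_diagonal, Matrix.diagonal_mul]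
  have h2 : ∀ (b : B) (d : K × B → ℝ),
      (Matrix.of fun p q => (d p : ℂ) * Y (p.1, b) (q.1, b) * (d q : ℂ)).PosSemidef := by
    intro b d
    have h := (hY.submatrix (fun p : K × B => (p.1, b))).mul_mul_conjTranspose_same
      (Matrix.diagonal fun p => (d p : ℂ))
    convert h using 1
    ext p q
    simp [Matrix.diagonal_conjTranspose, Matrix.mul_diagonal, Matrix.diagonal_mul]
  have h3 := Matrix.posSemidef_sum (Finset.univ : Finset (B × B)) fun i _ =>
    h1 fun p => (if p.2 = i.1 then 1 else 0) - (if p.2 = i.2 then 1 else 0)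
  have h4 := Matrix.posSemidef_sum ((Finset.univ : Finset (B × B)).filter fun i => i.1 ≠ i.2)
    fun i _ => h2 i.1 fun p => if p.2 = i.2 then 1 else 0
  have h5 := (h3.smul (show (0 : ℝ) ≤ 1 / 2 by norm_num)).add
    (h4.smul (show (0 : ℝ) ≤ Fintype.card B by positivity))
  convert h5 using 1
  ext p q
  simp only [Matrix.of_apply, Matrix.add_apply, Matrix.smul_apply, Matrix.sum_apply,
    Complex.real_smul]
  have e0 : ∀ (a c : B → ℂ) (y : ℂ), ∑ i : B × B, (a i.1 - a i.2) * y * (c i.1 - c i.2)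
      = 2 * (Fintype.card B * (∑ b, a b * c b) - (∑ b, a b) * ∑ b, c b) * y := by
    intro a c y
    have e (i j : B) : (a i - a j) * y * (c i - c j)
        = (a i * c i - a i * c j - a j * c i + a j * c j) * y := by ring
    simp only [Fintype.sum_prod_type, e, ← Finset.sum_mul, Finset.sum_add_distrib,
      Finset.sum_sub_distrib, ← Finset.mul_sum, Finset.sum_const, Finset.card_univ, nsmul_eq_mul,
      mul_assoc]
    ring
  have e1 := e0 (fun b => if p.2 = b then 1 else 0) (fun b => if q.2 = b then 1 else 0) (Y p q)
  have e2 : ∑ i ∈ (Finset.univ : Finset (B × B)).filter (fun i => i.1 ≠ i.2),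
      (if p.2 = i.2 then (1 : ℂ) else 0) * Y (p.1, i.1) (q.1, i.1)
        * (if q.2 = i.2 then (1 : ℂ) else 0)
      = if p.2 = q.2 then ∑ b, Y (p.1, b) (q.1, b) - Y p q else 0 := by
    rw [Finset.sum_filter, Fintype.sum_prod_type, Finset.sum_comm,
      Finset.sum_eq_single_of_mem p.2 (Finset.mem_univ _) (by
        intro b _ hb
        simp [hb.symm])]
    split_ifs with hpq
    · have e3 : (Finset.univ : Finset B).sum (fun b => Y (p.1, b) (q.1, b)) - Y p q
          = ∑ b, (Y (p.1, b) (q.1, b) - if b = p.2 then Y p q else 0) := by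
        simp [Finset.sum_sub_distrib]
      rw [e3]
      refine Finset.sum_congr rfl fun b _ => ?_
      by_cases hb : b = p.2
      · subst hb
        have : Y (p.1, p.2) (q.1, p.2) = Y p q := by rw [Prod.mk.eta, hpq, Prod.mk.eta]
        simp [this]
      · simp [hb, hpq.symm]
    · simp [Ne.symm hpq]
  have e4 : ∑ b, (if p.2 = b then (1 : ℂ) else 0) * (if q.2 = b then 1 else 0)
      = if p.2 = q.2 then 1 else 0 := by simp [eq_comm]
  simp only [Complex.ofReal_sub, apply_ite Complex.ofReal, Complex.ofReal_one, Complex.ofReal_zero]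
  rw [e1, e2, e4]
  simp only [Finset.sum_ite_eq, Finset.mem_univ, if_true]
  split_ifs
  · push_cast
    ring
  · push_cast
    ring

theorem isCP_smul_uniform_sub {A B : Type} [Fintype A] [Fintype B] [DecidableEq B] [Nonempty B]
    (N : Channel A B) :
    IsCP ((((Fintype.card B : ℝ) ^ 2 : ℝ) : ℂ) • (uniformChannel A B).1 - N.1) := by
  intro K _ X hX
  have h := posSemidef_partialTrace_sub (N.2.1 K X hX)
  convert h using 1
  ext p q
  have h1 : ∑ b, lTensor K N.1 X (p.1, b) (q.1, b)
      = Matrix.trace (Matrix.of fun a a' => X (p.1, a) (q.1, a')) :=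
    N.2.2 (Matrix.of fun a a' => X (p.1, a) (q.1, a'))
  have h0 : (Fintype.card B : ℂ) ≠ 0 := by simp
  rw [Matrix.of_apply, h1]
  simp only [lTensor, uniformChannel, uniformSuperop, LinearMap.coe_mk, AddHom.coe_mk,
    Matrix.of_apply, LinearMap.sub_apply, LinearMap.smul_apply, Matrix.sub_apply, Matrix.smul_apply,
    Matrix.one_apply, smul_eq_mul]
  push_cast
  split_ifs
  · field_simp
  · simp

theorem one_le_of_isCP {A B : Type} [Fintype A] [Nonempty A] [Fintype B] [DecidableEq B]
    [Nonempty B] (N : Channel A B) {t : ℝ}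
    (h : IsCP ((t : ℂ) • (uniformChannel A B).1 - N.1)) : 1 ≤ t := by
  classical
  have h1 := (h Unit (1 : Matrix (Unit × A) (Unit × A) ℂ) Matrix.PosSemidef.one).trace_nonneg
  have h2 : (Matrix.of fun a a' => (1 : Matrix (Unit × A) (Unit × A) ℂ) ((), a) ((), a'))
      = (1 : Matrix A A ℂ) := by
    ext a a'
    simp [Matrix.one_apply]
  have h3 : (lTensor Unit ((t : ℂ) • (uniformChannel A B).1 - N.1)
      (1 : Matrix (Unit × A) (Unit × A) ℂ)).trace
      = (((t : ℂ) • (uniformChannel A B).1 - N.1) (1 : Matrix A A ℂ)).trace := by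
    rw [← h2, Matrix.trace, Fintype.sum_prod_type]
    simp [Matrix.trace, lTensor]
  have h4 : (((t : ℂ) • (uniformChannel A B).1 - N.1) (1 : Matrix A A ℂ)).trace
      = (((t - 1) * Fintype.card A : ℝ) : ℂ) := by
    have e1 := (uniformChannel A B).2.2 (1 : Matrix A A ℂ)
    have e2 := N.2.2 (1 : Matrix A A ℂ)
    simp only [LinearMap.sub_apply, LinearMap.smul_apply, Matrix.trace_sub, Matrix.trace_smul,
      e1, e2, Matrix.trace_one, smul_eq_mul]
    push_cast
    ring
  rw [h3, h4, Complex.zero_le_real] at h1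
  have h5 : (0 : ℝ) < Fintype.card A := by exact_mod_cast Fintype.card_pos
  nlinarith [nonneg_of_mul_nonneg_left h1 h5]

theorem isClosed_isCP {A B : Type} [Finite B] (Φ Ψ : Superop A B) (h : IsCP Φ) (h' : IsCP Ψ) :
    IsClosed {t : ℝ | IsCP ((t : ℂ) • Φ - Ψ)} := by
  have := Fintype.ofFinite B
  have e : {t : ℝ | IsCP ((t : ℂ) • Φ - Ψ)} = ⋂ (K : Type), ⋂ (_ : Finite K),
      ⋂ (X : Matrix (K × A) (K × A) ℂ), ⋂ (_ : X.PosSemidef),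
        {t : ℝ | (lTensor K ((t : ℂ) • Φ - Ψ) X).PosSemidef} := by
    ext t
    simp [IsCP]
  rw [e]
  refine isClosed_iInter fun K => isClosed_iInter fun _ => isClosed_iInter fun X =>
    isClosed_iInter fun hX => ?_
  have := Fintype.ofFinite K
  have e1 : ∀ t : ℝ, lTensor K ((t : ℂ) • Φ - Ψ) X = (t : ℂ) • lTensor K Φ X - lTensor K Ψ X :=
    fun t => rfl
  have e2 : ∀ t : ℝ, ((t : ℂ) • lTensor K Φ X - lTensor K Ψ X).IsHermitian := fun t =>
    ((h K X hX).1.smul (by simp [IsSelfAdjoint])).sub (h' K X hX).1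
  simp only [e1, Matrix.posSemidef_iff_dotProduct_mulVec, e2, true_and, Set.ofPred_forall]
  refine isClosed_iInter fun x => ?_
  simp only [Matrix.sub_mulVec, Matrix.smul_mulVec, dotProduct_sub, dotProduct_smul]
  exact isClosed_le continuous_const (by fun_prop)

/-- The minimum that defines `D_max(𝒩‖ℛ)` is attained. -/
theorem isLeast_dmax_uniform {A B : Type} [Fintype A] [Nonempty A] [Fintype B] [DecidableEq B]
    [Nonempty B] (N : Channel A B) :
    IsLeast (dmaxSet N (uniformChannel A B)) (dmax N (uniformChannel A B)) := by
  set S : Set ℝ := {t : ℝ | IsCP ((t : ℂ) • (uniformChannel A B).1 - N.1)} with hS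
  have hb : BddBelow S := ⟨1, fun t ht => one_le_of_isCP N ht⟩
  have hm : sInf S ∈ S :=
    (isClosed_isCP _ _ (uniformChannel A B).2.1 N.2.1).csInf_mem ⟨_, isCP_smul_uniform_sub N⟩ hb
  have hl : IsLeast (dmaxSet N (uniformChannel A B)) (Real.logb 2 (sInf S)) := by
    refine ⟨⟨sInf S, lt_of_lt_of_le one_pos (one_le_of_isCP N hm), hm, rfl⟩, ?_⟩
    rintro x ⟨t, ht, hcp, rfl⟩
    exact Real.logb_le_logb_of_le one_lt_two (lt_of_lt_of_le one_pos (one_le_of_isCP N hm))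
      (csInf_le hb hcp)
  rw [dmax, hl.csInf_eq]
  exact hl

/-- The min-entropy of a channel, `H_min(B|A)_𝒩 = log₂ |B| - D_max(𝒩‖ℛ)`. -/
def channelMinEntropy : ChannelFunction := fun A B _ _ _ _ _ _ N =>
  Real.logb 2 (Fintype.card B) - dmax N (uniformChannel A B)

end QChannel

end

open scoped Kronecker ComplexOrder

noncomputable section

namespace QChannel

/-! Write `T` for `X ↦ Tr[X] · 1` and order superoperators by the completely positive cone. Since `ℛ
= T / |B|`, the term `log |B|` cancels and `2 ^ (-H_min(N))` is the least `s` with `N ≤ s T`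
(`le_channelMinEntropy_iff`). The whole proof works with this inequality.

A mixing superchannel preserves the order and sends `T` to `T`, which gives monotonicity; isometric
embeddings of the output do not change the constant `s`. One half of additivity is a telescoping
sum. The other half tests the inequality for `N ⊗ M` on product operators and product vectors, where
both sides factorize (`blockForm_tensor`), so the optimal constants multiply.

For minimality, the uniform state on `k` levels majorizes every `N` with `k N ≤ T`
(`majorizes_of_isCP`). The superchannel stores the input of `N` in the auxiliary system and tests
whether the source output lies in a fixed `k`-dimensional subspace. It applies `N` on success and
`(T - k N) / (|B| - k)` on failure. The second map is completely positive exactly because `k N ≤ T`,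
and it completes `N` to a conditionally unital channel.

Additivity and normalization give `m` uniform qubits entropy `m`, so any normalized entropy is at
least `H_min` rounded down to an integer, as long as that integer is positive. Tensoring with
uniform qubits secures positivity, and passing to tensor powers makes the rounding error negligible.
-/

/-! ### Min-entropy as an inequality in the completely positive order -/

/-- The completely positive map `X ↦ Tr[X] · 1`. -/
def traceOne (A B : Type) [Fintype A] [DecidableEq B] : Superop A B where
  toFun X := X.trace • (1 : Matrix B B ℂ)
  map_add' X Y := by simp [add_smul]
  map_smul' c X := by simp [smul_smul]

theorem traceOne_apply {A B : Type} [Fintype A] [DecidableEq B] (X : Matrix A A ℂ) :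
    traceOne A B X = X.trace • (1 : Matrix B B ℂ) := rfl

theorem smul_uniformSuperop {A B : Type} [Fintype A] [Fintype B] [DecidableEq B] [Nonempty B]
    (t : ℝ) : (((Fintype.card B : ℝ) * t : ℝ) : ℂ) • uniformSuperop A B
      = (t : ℂ) • traceOne A B := by
  have h0 : (Fintype.card B : ℂ) ≠ 0 := by simp
  refine LinearMap.ext fun X => ?_
  simp only [LinearMap.smul_apply, traceOne_apply, uniformSuperop, LinearMap.coe_mk,
    AddHom.coe_mk, smul_smul]
  congr 1
  push_cast
  field_simp

theorem isCP_add {A B : Type} {Φ Ψ : Superop A B} (h : IsCP Φ) (h' : IsCP Ψ) : IsCP (Φ + Ψ) :=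
  fun K _ X hX => (h K X hX).add (h' K X hX)

theorem isCP_smul {A B : Type} {Φ : Superop A B} (h : IsCP Φ) {c : ℝ} (hc : 0 ≤ c) :
    IsCP ((c : ℂ) • Φ) :=
  fun K _ X hX => (h K X hX).smul (α := ℂ) (by exact_mod_cast hc)

theorem isCP_traceOne (A B : Type) [Fintype A] [Fintype B] [DecidableEq B] [Nonempty B] :
    IsCP (traceOne A B) := by
  have h := smul_uniformSuperop (A := A) (B := B) 1
  rw [Complex.ofReal_one, one_smul] at h
  rw [← h]
  exact isCP_smul (isCP_uniformSuperop A B) (by positivity)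

theorem isCP_conjBy {A B : Type} [Fintype A] [Fintype B] (V : Matrix B A ℂ) :
    IsCP (conjBy V) := by
  classical
  intro K _ X hX
  have := Fintype.ofFinite K
  have h := hX.mul_mul_conjTranspose_same ((1 : Matrix K K ℂ) ⊗ₖ V)
  convert h using 1
  ext p q
  simp [lTensor, conjBy, Matrix.mul_apply, Matrix.kroneckerMap_apply, Fintype.sum_prod_type,
    Matrix.one_apply, apply_ite]

theorem isCP_tensor {A B A' B' : Type} [Finite A] [Finite B'] {Φ : Superop A B}
    {Ψ : Superop A' B'} (h : IsCP Φ) (h' : IsCP Ψ) : IsCP (tensor Φ Ψ) :=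
  isCP_comp (isCP_rTensor B' h) (isCP_lTensor A h')

theorem isCP_traceOne_sub_mono {A B : Type} [Fintype A] [Fintype B] [DecidableEq B] [Nonempty B]
    {N : Superop A B} {s t : ℝ} (hst : s ≤ t) (h : IsCP ((s : ℂ) • traceOne A B - N)) :
    IsCP ((t : ℂ) • traceOne A B - N) := by
  have e : (t : ℂ) • traceOne A B - N
      = ((t - s : ℝ) : ℂ) • traceOne A B + ((s : ℂ) • traceOne A B - N) := by
    refine LinearMap.ext fun X => ?_
    simp only [LinearMap.sub_apply, LinearMap.add_apply, LinearMap.smul_apply, Complex.ofReal_sub,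
      sub_smul]
    abel
  rw [e]
  exact isCP_add (isCP_smul (isCP_traceOne A B) (sub_nonneg.2 hst)) h

/-- A lower bound on the min-entropy is an operator inequality. -/
theorem le_channelMinEntropy_iff {A B : Type} [Fintype A] [DecidableEq A] [Nonempty A] [Fintype B]
    [DecidableEq B] [Nonempty B] (N : Channel A B) (x : ℝ) :
    x ≤ channelMinEntropy A B N ↔ IsCP ((((2 : ℝ) ^ (-x) : ℝ) : ℂ) • traceOne A B - N.1) := by
  have hl := isLeast_dmax_uniform N
  have hB : (0 : ℝ) < Fintype.card B := by exact_mod_cast Fintype.card_pos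
  have hlog : Real.logb 2 ((Fintype.card B : ℝ) * 2 ^ (-x)) = Real.logb 2 (Fintype.card B) - x := by
    rw [Real.logb_mul hB.ne' (by positivity), Real.logb_rpow two_pos (by norm_num), sub_eq_add_neg]
  rw [channelMinEntropy, ← smul_uniformSuperop]
  constructor
  · intro hx
    obtain ⟨t, ht, hcp, he⟩ := hl.1
    have h1 : Real.logb 2 t ≤ Real.logb 2 ((Fintype.card B : ℝ) * 2 ^ (-x)) := by
      rw [hlog, ← he]
      linarith
    have h2 := (Real.logb_le_logb one_lt_two ht (by positivity)).1 h1
    have e : t = (Fintype.card B : ℝ) * (t / Fintype.card B) := by field_simp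
    rw [uniformChannel, e, smul_uniformSuperop] at hcp
    rw [smul_uniformSuperop]
    refine isCP_traceOne_sub_mono ?_ hcp
    rwa [div_le_iff₀' hB]
  · intro h
    have h1 := hl.2 ⟨_, by positivity, h, rfl⟩
    rw [hlog] at h1
    linarith

theorem isCP_rpow_channelMinEntropy {A B : Type} [Fintype A] [DecidableEq A] [Nonempty A]
    [Fintype B] [DecidableEq B] [Nonempty B] (N : Channel A B) :
    IsCP ((((2 : ℝ) ^ (-channelMinEntropy A B N) : ℝ) : ℂ) • traceOne A B - N.1) :=
  (le_channelMinEntropy_iff N _).1 le_rfl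

/-! ### Monotonicity under channel majorization -/

-- Conditional unitality speaks only of states; this spanning property extends it by linearity to
-- all operators on the auxiliary system.
open scoped MatrixOrder Matrix.Norms.L2Operator in
theorem span_posSemidef (R : Type) [Fintype R] :
    Submodule.span ℂ {X : Matrix R R ℂ | X.PosSemidef} = ⊤ := by
  classical
  have h := CStarAlgebra.span_nonneg (A := Matrix R R ℂ)
  simpa only [Matrix.nonneg_iff_posSemidef] using h

/-- A conditionally unital map sends `τ ⊗ 1` to `Tr[τ] · 1`. -/
theorem IsConditionallyUnital.apply_kronecker_one {R B : Type} [Fintype R] [DecidableEq B]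
    {E : Superop (R × B) B} (hE : IsConditionallyUnital E) (τ : Matrix R R ℂ) :
    E (τ ⊗ₖ (1 : Matrix B B ℂ)) = τ.trace • (1 : Matrix B B ℂ) := by
  have hmem : τ ∈ Submodule.span ℂ {X : Matrix R R ℂ | X.PosSemidef} := by
    rw [span_posSemidef]
    trivial
  induction hmem using Submodule.span_induction with
  | zero => simp
  | add X Y _ _ hX hY => rw [Matrix.add_kronecker, map_add, hX, hY, Matrix.trace_add, add_smul]
  | smul c X _ hX =>
    rw [Matrix.smul_kronecker, map_smul, hX, Matrix.trace_smul, smul_smul, smul_eq_mul]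
  | mem X hX =>
    have hX : X.PosSemidef := hX
    -- A positive operator of trace zero vanishes; any other is a multiple of a state.
    by_cases h0 : X.trace = 0
    · rw [hX.trace_eq_zero_iff.1 h0]
      simp
    · have h1 : IsState (X.trace⁻¹ • X) := by
        refine ⟨hX.smul (α := ℂ) ?_, by simp [Matrix.trace_smul, h0]⟩
        exact inv_nonneg.2 hX.trace_nonneg
      have h2 := hE _ h1
      rw [Matrix.smul_kronecker, map_smul] at h2
      exact (inv_smul_eq_iff₀ h0).1 h2

theorem isIsometry_trace_conjBy {A B : Type} [Fintype A] [DecidableEq A] [Fintype B]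
    {V : Matrix B A ℂ} (hV : IsIsometry V) (X : Matrix A A ℂ) :
    (conjBy V X).trace = X.trace := by
  change (V * X * V.conjTranspose).trace = _
  rw [Matrix.trace_mul_comm, ← Matrix.mul_assoc, hV, Matrix.one_mul]

/-- `Θ` fixes `Tr[·] 1`: applying it to part of the isometry's output leaves `τ ⊗ 1` with `Tr τ = Tr
X`, which conditional unitality sends to `Tr[X] 1`. Being linear and preserving complete positivity,
`Θ` carries the inequality along. -/
theorem IsMixing.isCP_traceOne_sub {A A' B : Type} [Fintype A] [Fintype A'] [DecidableEq A']
    [Fintype B] [DecidableEq B] {Θ : Superop A B →ₗ[ℂ] Superop A' B} (hΘ : IsMixing Θ)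
    {N : Superop A B} {s : ℝ} (h : IsCP ((s : ℂ) • traceOne A B - N)) :
    IsCP ((s : ℂ) • traceOne A' B - Θ N) := by
  obtain ⟨R, _, V, E, ⟨⟨hV, ⟨hE, -⟩, hΘ⟩, -⟩, hu⟩ := hΘ
  have e : Θ (traceOne A B) = traceOne A' B := by
    rw [hΘ]
    refine LinearMap.ext fun X => ?_
    have e1 : lTensor R (traceOne A B) (conjBy V X) = (Matrix.of fun r r' : R =>
        ∑ a, conjBy V X (r, a) (r', a)) ⊗ₖ (1 : Matrix B B ℂ) := by
      ext p q
      simp [lTensor, traceOne, Matrix.kroneckerMap_apply, Matrix.trace]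
    rw [LinearMap.comp_apply, LinearMap.comp_apply, e1, hu.apply_kronecker_one, traceOne_apply,
      ← isIsometry_trace_conjBy hV X]
    congr 1
    simp [Matrix.trace, Fintype.sum_prod_type]
  rw [← e, ← map_smul, ← map_sub, hΘ]
  exact isCP_comp hE (isCP_comp (isCP_lTensor R h) (isCP_conjBy V))

/-- Compression by `Uᴴ` undoes the embedding and sends the identity of `C` to that of `B`. -/
theorem isCP_traceOne_sub_of_conjBy {A B C : Type} [Fintype A] [Fintype B] [DecidableEq B]
    [Fintype C] [DecidableEq C] {U : Matrix C B ℂ} (hU : IsIsometry U) {N : Superop A B} {s : ℝ}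
    (h : IsCP ((s : ℂ) • traceOne A C - conjBy U ∘ₗ N)) : IsCP ((s : ℂ) • traceOne A B - N) := by
  have h1 := isCP_comp (isCP_conjBy U.conjTranspose) h
  convert h1 using 1
  refine LinearMap.ext fun X => ?_
  have e (Y : Matrix B B ℂ) : U.conjTranspose * (U * Y * U.conjTranspose) * U = Y := by
    have : U.conjTranspose * (U * Y * U.conjTranspose) * U
      = (U.conjTranspose * U) * Y * (U.conjTranspose * U) := by simp only [Matrix.mul_assoc]
    rw [this, hU, Matrix.one_mul, Matrix.mul_one]
  have hU' : U.conjTranspose * U = 1 := hU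
  simp [conjBy, traceOne, Matrix.mul_sub, Matrix.sub_mul, e, hU']

/-- The difference splits as `s Tr[·] (1 - V Vᴴ)`, supported off the range of `V`, plus the original
difference conjugated by `V`. -/
theorem isCP_traceOne_sub_conjBy {A B C : Type} [Fintype A] [Fintype B] [DecidableEq B] [Nonempty B]
    [Fintype C] [DecidableEq C] {V : Matrix C B ℂ} (hV : IsIsometry V) {N : Superop A B} {s : ℝ}
    (hs : 0 ≤ s) (h : IsCP ((s : ℂ) • traceOne A B - N)) :
    IsCP ((s : ℂ) • traceOne A C - conjBy V ∘ₗ N) := by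
  have hV' : V.conjTranspose * V = 1 := hV
  obtain ⟨c⟩ : Nonempty C := by
    by_contra hC
    have := not_nonempty_iff.1 hC
    have h1 := congrArg Matrix.trace hV'
    rw [Matrix.trace_mul_comm, Matrix.trace_one] at h1
    simp [Matrix.trace, eq_comm] at h1
  have : Nonempty C := ⟨c⟩
  have h1 := isCP_add (isCP_smul (isCP_comp (isCP_conjBy (1 - V * V.conjTranspose))
    (isCP_traceOne A C)) hs) (isCP_comp (isCP_conjBy V) h)
  convert h1 using 1
  refine LinearMap.ext fun X => ?_
  have e : V * V.conjTranspose * (V * V.conjTranspose) = V * V.conjTranspose := by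
    rw [Matrix.mul_assoc, ← Matrix.mul_assoc V.conjTranspose, hV', Matrix.one_mul]
  simp [conjBy, traceOne, Matrix.mul_sub, Matrix.sub_mul, e, smul_sub]

theorem channelMinEntropy_monotone {A B A' B' : Type} [Fintype A] [DecidableEq A] [Nonempty A]
    [Fintype B] [DecidableEq B] [Nonempty B] [Fintype A'] [DecidableEq A'] [Nonempty A']
    [Fintype B'] [DecidableEq B'] [Nonempty B'] {N : Channel A B} {M : Channel A' B'}
    (h : Majorizes N M) : channelMinEntropy A B N ≤ channelMinEntropy A' B' M := by
  rw [le_channelMinEntropy_iff]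
  have h0 := isCP_rpow_channelMinEntropy N
  obtain ⟨-, U, hU, Θ, hΘ, e⟩ | ⟨-, V, hV, Θ, hΘ, e⟩ := h
  · refine isCP_traceOne_sub_of_conjBy hU ?_
    rw [e]
    exact hΘ.isCP_traceOne_sub h0
  · rw [e]
    exact hΘ.isCP_traceOne_sub (isCP_traceOne_sub_conjBy hV (by positivity) h0)


/-! ### Additivity under tensor products -/

theorem tensor_traceOne (A B A' B' : Type) [Fintype A] [Fintype A'] [DecidableEq B]
    [DecidableEq B'] : tensor (traceOne A B) (traceOne A' B') = traceOne (A × A') (B × B') := by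
  refine LinearMap.ext fun X => ?_
  ext p q
  simp [tensor, lTensor, rTensor, traceOne, Matrix.trace, Fintype.sum_prod_type, Matrix.one_apply,
    Prod.ext_iff, ite_and]

theorem tensor_smul_sub_left {A B A' B' : Type} (s : ℂ) (Φ Φ' : Superop A B) (Ψ : Superop A' B') :
    tensor (s • Φ - Φ') Ψ = s • tensor Φ Ψ - tensor Φ' Ψ := rfl

theorem tensor_smul_sub_right {A B A' B' : Type} (s : ℂ) (Φ : Superop A B)
    (Ψ Ψ' : Superop A' B') : tensor Φ (s • Ψ - Ψ') = s • tensor Φ Ψ - tensor Φ Ψ' := by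
  have e : lTensor A (s • Ψ - Ψ') = s • lTensor A Ψ - lTensor A Ψ' := rfl
  rw [tensor, e, LinearMap.comp_sub, LinearMap.comp_smul]
  rfl

theorem tensor_smul_left {A B A' B' : Type} (s : ℂ) (Φ : Superop A B) (Ψ : Superop A' B') :
    tensor (s • Φ) Ψ = s • tensor Φ Ψ := rfl

theorem channelMinEntropy_add_le {A B A' B' : Type} [Fintype A] [DecidableEq A] [Nonempty A]
    [Fintype B] [DecidableEq B] [Nonempty B] [Fintype A'] [DecidableEq A'] [Nonempty A']
    [Fintype B'] [DecidableEq B'] [Nonempty B'] (N : Channel A B) (M : Channel A' B') :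
    channelMinEntropy A B N + channelMinEntropy A' B' M
      ≤ channelMinEntropy (A × A') (B × B') (N.tensor M) := by
  rw [le_channelMinEntropy_iff, neg_add, Real.rpow_add two_pos]
  have hN := isCP_rpow_channelMinEntropy N
  have hM := isCP_rpow_channelMinEntropy M
  generalize ((2 : ℝ) ^ (-channelMinEntropy A' B' M)) = t at *
  have hs : (0 : ℝ) ≤ 2 ^ (-channelMinEntropy A B N) := by positivity
  generalize ((2 : ℝ) ^ (-channelMinEntropy A B N)) = s at *
  -- Telescoping: `st T ⊗ T - N ⊗ M = s T ⊗ (t T - M) + (s T - N) ⊗ M`.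
  have h := isCP_add (isCP_tensor (isCP_smul (isCP_traceOne A B) hs) hM) (isCP_tensor hN M.2.1)
  convert h using 1
  rw [← tensor_traceOne, tensor_smul_sub_left, tensor_smul_sub_right, tensor_smul_left,
    tensor_smul_left]
  refine LinearMap.ext fun X => ?_
  simp only [LinearMap.sub_apply, LinearMap.add_apply, LinearMap.smul_apply, Complex.ofReal_mul,
    mul_smul, smul_comm (s : ℂ) (t : ℂ), Channel.tensor]
  abel

/-- The quadratic form of `(id ⊗ Φ) X`. -/
def blockForm {A B : Type} [Fintype B] (Φ : Superop A B) (K : Type) [Fintype K]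
    (X : Matrix (K × A) (K × A) ℂ) (w : K × B → ℂ) : ℂ :=
  star w ⬝ᵥ (lTensor K Φ X).mulVec w

theorem IsCP.blockForm_nonneg {A B : Type} [Fintype B] {Φ : Superop A B} (h : IsCP Φ) {K : Type}
    [Fintype K] {X : Matrix (K × A) (K × A) ℂ} (hX : X.PosSemidef) (w : K × B → ℂ) :
    0 ≤ blockForm Φ K X w :=
  (Matrix.posSemidef_iff_dotProduct_mulVec.1 (h K X hX)).2 w

theorem blockForm_smul_sub {A B : Type} [Fintype B] (Φ Ψ : Superop A B) (s : ℂ) (K : Type)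
    [Fintype K] (X : Matrix (K × A) (K × A) ℂ) (w : K × B → ℂ) :
    blockForm (s • Φ - Ψ) K X w = s * blockForm Φ K X w - blockForm Ψ K X w := by
  have e : lTensor K (s • Φ - Ψ) X = s • lTensor K Φ X - lTensor K Ψ X := rfl
  simp only [blockForm, e, Matrix.sub_mulVec, Matrix.smul_mulVec, dotProduct_sub, dotProduct_smul,
    smul_eq_mul]

/-- Turns the operator inequality into inequalities between real numbers, which can be divided; both
forms are real because `Φ` and `Ψ` are completely positive. -/
theorem isCP_smul_sub_iff {A B : Type} [Fintype B] {Φ Ψ : Superop A B} (h : IsCP Φ) (h' : IsCP Ψ)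
    (s : ℝ) : IsCP ((s : ℂ) • Φ - Ψ) ↔ ∀ (K : Type) [Fintype K] (X : Matrix (K × A) (K × A) ℂ),
      X.PosSemidef → ∀ w, (blockForm Ψ K X w).re ≤ s * (blockForm Φ K X w).re := by
  constructor
  · intro hc K _ X hX w
    have h1 := (Complex.nonneg_iff.1 (hc.blockForm_nonneg hX w)).1
    rw [blockForm_smul_sub, Complex.sub_re, Complex.re_ofReal_mul] at h1
    linarith
  · intro hq K _ X hX
    have := Fintype.ofFinite K
    have hH : ((s : ℂ) • lTensor K Φ X - lTensor K Ψ X).IsHermitian :=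
      ((h K X hX).1.smul (by simp [IsSelfAdjoint])).sub (h' K X hX).1
    refine Matrix.posSemidef_iff_dotProduct_mulVec.2 ⟨hH, fun w => ?_⟩
    change 0 ≤ blockForm _ K X w
    rw [blockForm_smul_sub, Complex.nonneg_iff]
    have i1 := (Complex.nonneg_iff.1 (h.blockForm_nonneg hX w)).2
    have i2 := (Complex.nonneg_iff.1 (h'.blockForm_nonneg hX w)).2
    rw [Complex.sub_re, Complex.re_ofReal_mul, Complex.sub_im, Complex.im_ofReal_mul, ← i1, ← i2]
    exact ⟨sub_nonneg.2 (hq K X hX w), by simp⟩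

/-- The block form of a tensor product at product arguments. -/
theorem blockForm_tensor {A B A' B' : Type} [Fintype B] [Fintype B'] (Φ : Superop A B)
    (Ψ : Superop A' B') {K L : Type} [Fintype K] [Fintype L] (X : Matrix (K × A) (K × A) ℂ)
    (Y : Matrix (L × A') (L × A') ℂ) (v : K × B → ℂ) (w : L × B' → ℂ) :
    blockForm (tensor Φ Ψ) (K × L)
      ((X ⊗ₖ Y).submatrix (fun p => ((p.1.1, p.2.1), (p.1.2, p.2.2)))
        (fun p => ((p.1.1, p.2.1), (p.1.2, p.2.2))))
      (fun p => v (p.1.1, p.2.1) * w (p.1.2, p.2.2))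
      = blockForm Φ K X v * blockForm Ψ L Y w := by
  have e : ∀ p q, lTensor (K × L) (tensor Φ Ψ)
      ((X ⊗ₖ Y).submatrix (fun p => ((p.1.1, p.2.1), (p.1.2, p.2.2)))
        (fun p => ((p.1.1, p.2.1), (p.1.2, p.2.2)))) p q
      = lTensor K Φ X (p.1.1, p.2.1) (q.1.1, q.2.1) * lTensor L Ψ Y (p.1.2, p.2.2) (q.1.2, q.2.2) :=
    fun p q => congrFun (congrFun (tensor_kronecker Φ Ψ
      (Matrix.of fun a a' => X (p.1.1, a) (q.1.1, a'))
      (Matrix.of fun a a' => Y (p.1.2, a) (q.1.2, a'))) p.2) q.2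
  simp only [blockForm, dotProduct, Matrix.mulVec, e, Pi.star_apply]
  rw [Finset.sum_mul_sum, ← Finset.sum_product', Finset.univ_product_univ]
  refine Fintype.sum_equiv (Equiv.prodProdProdComm K L B B') _ _ fun p => ?_
  simp only [Equiv.prodProdProdComm_apply, star_mul']
  rw [mul_mul_mul_comm, Finset.sum_mul_sum, ← Finset.sum_product', Finset.univ_product_univ]
  congr 1
  refine Fintype.sum_equiv (Equiv.prodProdProdComm K L B B') _ _ fun q => ?_
  simp only [Equiv.prodProdProdComm_apply]
  ring

theorem rpow_neg_channelMinEntropy_le_iff {A B : Type} [Fintype A] [DecidableEq A] [Nonempty A]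
    [Fintype B] [DecidableEq B] [Nonempty B] (N : Channel A B) {s : ℝ} (hs : 0 < s) :
    2 ^ (-channelMinEntropy A B N) ≤ s ↔ IsCP ((s : ℂ) • traceOne A B - N.1) := by
  have e : s = 2 ^ (-(-Real.logb 2 s)) := by
    rw [neg_neg, Real.rpow_logb two_pos (by norm_num) hs]
  conv_rhs => rw [e]
  rw [← le_channelMinEntropy_iff, ← neg_le, Real.le_logb_iff_rpow_le one_lt_two hs]

/-- Fix a test `(X, v)` for `N`, with value `a` on `Tr[·] 1` and `b` on `N`. The product tests then
say `M ≤ (s a / b) Tr[·] 1`, so `t ≤ s a / b` by optimality of `t`. Read as `b ≤ (s / t) a` for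
every `(X, v)`, this is `N ≤ (s / t) Tr[·] 1`. -/
theorem channelMinEntropy_le_add {A B A' B' : Type} [Fintype A] [DecidableEq A] [Nonempty A]
    [Fintype B] [DecidableEq B] [Nonempty B] [Fintype A'] [DecidableEq A'] [Nonempty A']
    [Fintype B'] [DecidableEq B'] [Nonempty B'] (N : Channel A B) (M : Channel A' B') :
    channelMinEntropy (A × A') (B × B') (N.tensor M)
      ≤ channelMinEntropy A B N + channelMinEntropy A' B' M := by
  set s : ℝ := 2 ^ (-channelMinEntropy (A × A') (B × B') (N.tensor M)) with hs
  have hs0 : 0 < s := by positivity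
  set t : ℝ := 2 ^ (-channelMinEntropy A' B' M) with ht
  have ht0 : 0 < t := by positivity
  have hNM := (isCP_smul_sub_iff (isCP_traceOne _ _) (N.tensor M).2.1 s).1
    (isCP_rpow_channelMinEntropy (N.tensor M))
  have hN := (isCP_smul_sub_iff (isCP_traceOne _ _) N.2.1 _).1 (isCP_rpow_channelMinEntropy N)
  have key : 2 ^ (-channelMinEntropy A B N) ≤ s / t := by
    rw [rpow_neg_channelMinEntropy_le_iff N (by positivity),
      isCP_smul_sub_iff (isCP_traceOne _ _) N.2.1]
    intro K _ X hX v
    have ha := Complex.nonneg_iff.1 ((isCP_traceOne A B).blockForm_nonneg hX v)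
    have hb := Complex.nonneg_iff.1 (N.2.1.blockForm_nonneg hX v)
    have hab := hN K X hX v
    have hprod := fun (L : Type) [Fintype L] (Y : Matrix (L × A') (L × A') ℂ) (hY : Y.PosSemidef)
      (w : L × B' → ℂ) => hNM (K × L) _ ((hX.kronecker hY).submatrix
        (fun p => ((p.1.1, p.2.1), (p.1.2, p.2.2)))) (fun p => v (p.1.1, p.2.1) * w (p.1.2, p.2.2))
    simp only [← tensor_traceOne, Channel.tensor, blockForm_tensor, Complex.mul_re, ← ha.2, ← hb.2,
      zero_mul, sub_zero] at hprod
    set a := (blockForm (traceOne A B) K X v).re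
    set b := (blockForm N.1 K X v).re
    obtain hb0 | hb0 := hb.1.eq_or_lt
    · rw [← hb0]
      exact mul_nonneg (by positivity) ha.1
    -- Positivity of `a` makes `s a / b` an admissible constant for `M`.
    have ha0 : 0 < a := pos_of_mul_pos_right (hb0.trans_le hab) (by positivity)
    have h1 : t ≤ s * a / b := by
      rw [ht, rpow_neg_channelMinEntropy_le_iff M (by positivity),
        isCP_smul_sub_iff (isCP_traceOne _ _) M.2.1]
      intro L _ Y hY w
      have := hprod L Y hY w
      rw [div_mul_eq_mul_div, le_div_iff₀ hb0]
      linarith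
    rw [le_div_iff₀ hb0] at h1
    rw [div_mul_eq_mul_div, le_div_iff₀ ht0]
    linarith
  rw [le_div_iff₀ ht0, ht, hs, ← Real.rpow_add two_pos, Real.rpow_le_rpow_left_iff one_lt_two] at key
  linarith

theorem channelMinEntropy_tensor {A B A' B' : Type} [Fintype A] [DecidableEq A] [Nonempty A]
    [Fintype B] [DecidableEq B] [Nonempty B] [Fintype A'] [DecidableEq A'] [Nonempty A']
    [Fintype B'] [DecidableEq B'] [Nonempty B'] (N : Channel A B) (M : Channel A' B') :
    channelMinEntropy (A × A') (B × B') (N.tensor M)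
      = channelMinEntropy A B N + channelMinEntropy A' B' M :=
  (channelMinEntropy_le_add N M).antisymm (channelMinEntropy_add_le N M)

/-! ### Uniform channels and normalization -/

theorem channelMinEntropy_uniformChannel (A B : Type) [Fintype A] [DecidableEq A] [Nonempty A]
    [Fintype B] [DecidableEq B] [Nonempty B] :
    channelMinEntropy A B (uniformChannel A B) = Real.logb 2 (Fintype.card B) := by
  have h : IsLeast (dmaxSet (uniformChannel A B) (uniformChannel A B)) 0 := by
    refine ⟨⟨1, one_pos, ?_, by simp⟩, ?_⟩
    · have e : ((1 : ℝ) : ℂ) • (uniformChannel A B).1 - (uniformChannel A B).1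
          = ((0 : ℝ) : ℂ) • traceOne A B := by simp
      rw [e]
      exact isCP_smul (isCP_traceOne A B) le_rfl
    · rintro x ⟨t, -, hcp, rfl⟩
      exact Real.logb_nonneg one_lt_two (one_le_of_isCP _ hcp)
  rw [channelMinEntropy, (isLeast_dmax_uniform (uniformChannel A B)).unique h, sub_zero]

theorem isNormalized_channelMinEntropy : IsNormalized channelMinEntropy := by
  rw [IsNormalized, channelMinEntropy_uniformChannel]
  simp

theorem isChannelEntropy_channelMinEntropy : IsChannelEntropy channelMinEntropy where
  nonzero := ⟨Unit, Fin 2, inferInstance, inferInstance, inferInstance, inferInstance,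
    inferInstance, inferInstance, uniformChannel Unit (Fin 2), by
      have h := isNormalized_channelMinEntropy
      rw [IsNormalized] at h
      rw [h]
      exact one_ne_zero⟩
  monotone _ _ _ _ _ _ _ _ _ _ _ _ _ _ _ _ _ _ h := channelMinEntropy_monotone h
  additive _ _ _ _ _ _ _ _ _ _ _ _ _ _ _ _ N M := channelMinEntropy_tensor N M


/-! ### Majorization by uniform states -/

/-- The weighted partial trace `X ↦ Tr_B[X (1 ⊗ diag q)]`. -/
def weightedTrace (A : Type) {B : Type} [Fintype B] (q : B → ℝ) : Superop (A × B) A where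
  toFun X := Matrix.of fun a a' => ∑ b, (q b : ℂ) * X (a, b) (a', b)
  map_add' X Y := by
    ext a a'
    simp [mul_add, Finset.sum_add_distrib]
  map_smul' c X := by
    ext a a'
    simp [Finset.mul_sum, mul_left_comm]

theorem isCP_weightedTrace (A : Type) {B : Type} [Fintype B] {q : B → ℝ} (hq : ∀ b, 0 ≤ q b) :
    IsCP (weightedTrace A q) := by
  intro K _ X hX
  have h := Matrix.posSemidef_sum (Finset.univ : Finset B) fun b _ =>
    (hX.submatrix (fun p : K × A => (p.1, (p.2, b)))).smul (α := ℂ) (a := (q b : ℂ))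
      (by exact_mod_cast hq b)
  convert h using 1
  ext p p'
  simp [lTensor, weightedTrace, Matrix.sum_apply]

theorem weightedTrace_kronecker {A B : Type} [Fintype B] (q : B → ℝ) (X : Matrix A A ℂ)
    (Y : Matrix B B ℂ) : weightedTrace A q (X ⊗ₖ Y) = (∑ b, (q b : ℂ) * Y b b) • X := by
  ext a a'
  simp only [weightedTrace, LinearMap.coe_mk, AddHom.coe_mk, Matrix.of_apply,
    Matrix.kroneckerMap_apply, Matrix.smul_apply, smul_eq_mul, Finset.sum_mul]
  exact Finset.sum_congr rfl fun b _ => by ring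

/-- The supermap implemented by an auxiliary system, a pre- and a post-processing. -/
def supermap {A A' B : Type} [Fintype A] [Fintype A'] (R : Type) [Fintype R]
    (V : Matrix (R × A) A' ℂ) (E : Superop (R × B) B) : Superop A B →ₗ[ℂ] Superop A' B where
  toFun N := E ∘ₗ lTensor R N ∘ₗ conjBy V
  map_add' N M := by
    have e : lTensor R (N + M) = lTensor R N + lTensor R M := rfl
    rw [e, LinearMap.add_comp, LinearMap.comp_add]
  map_smul' c N := by
    have e : lTensor R (c • N) = c • lTensor R N := rfl
    rw [e, LinearMap.smul_comp, LinearMap.comp_smul]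
    rfl

theorem IsIsometry.card_le {A B : Type} [Fintype A] [DecidableEq A] [Fintype B] {V : Matrix B A ℂ}
    (hV : IsIsometry V) : Fintype.card A ≤ Fintype.card B := by
  have h1 : (V.conjTranspose * V).rank = Fintype.card A := by rw [hV, Matrix.rank_one]
  rw [← h1]
  exact (Matrix.rank_mul_le_right _ _).trans (Matrix.rank_le_card_height V)

/-- If the input of the source channel is trivial, a mixing superchannel may store its whole input
in the auxiliary system. -/
theorem isMixing_supermap {A₀ A B : Type} [Fintype A₀] [Fintype A] [DecidableEq A] [Fintype B]
    [DecidableEq B] (hA₀ : Fintype.card A₀ = 1) {V : Matrix (A × A₀) A ℂ} (hV : IsIsometry V)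
    {E : Superop (A × B) B} (hE : IsCP E ∧ IsTP E) (hu : IsConditionallyUnital E) :
    IsMixing (supermap A V E) :=
  -- Standard form: in any realization the isometry embeds `A` into `R' × A₀`, and `|A₀| = 1`, so
  -- `|A| ≤ |R'|`.
  ⟨A, inferInstance, V, E, ⟨⟨hV, hE, fun _ => rfl⟩, fun R' _ V' E' h => by
    simpa [hA₀] using h.isometry.card_le⟩, hu⟩

/-- The isometry that permutes basis vectors along an embedding. -/
def embeddingMatrix {A B : Type} [DecidableEq B] (f : A → B) : Matrix B A ℂ :=
  Matrix.of fun b a => if f a = b then 1 else 0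

theorem isIsometry_embeddingMatrix {A B : Type} [DecidableEq A] [Fintype B] [DecidableEq B]
    {f : A → B} (hf : Function.Injective f) : IsIsometry (embeddingMatrix f) := by
  ext a a'
  simp [embeddingMatrix, Matrix.mul_apply, Matrix.one_apply, hf.eq_iff, eq_comm]

open scoped Classical in
theorem embeddingMatrix_mul_conjTranspose {A B : Type} [Fintype A] [DecidableEq B]
    {f : A → B} (hf : Function.Injective f) :
    embeddingMatrix f * (embeddingMatrix f).conjTranspose
      = Matrix.diagonal fun b => if b ∈ Set.range f then (1 : ℂ) else 0 := by
  ext b b'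
  rw [Matrix.diagonal_apply]
  by_cases h : b ∈ Set.range f
  · obtain ⟨a, rfl⟩ := h
    rw [Matrix.mul_apply, Finset.sum_eq_single a (fun x _ hx => by
      simp [embeddingMatrix, hf.ne hx]) (by simp)]
    simp [embeddingMatrix]
  · have h' : ∀ a, f a ≠ b := fun a ha => h ⟨a, ha⟩
    simp [embeddingMatrix, Matrix.mul_apply, h']

theorem one_le_mul_card_of_isCP {A B : Type} [Fintype A] [Nonempty A] [Fintype B] [DecidableEq B]
    [Nonempty B] (N : Channel A B) {s : ℝ} (h : IsCP ((s : ℂ) • traceOne A B - N.1)) :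
    1 ≤ (Fintype.card B : ℝ) * s := by
  rw [← smul_uniformSuperop] at h
  exact one_le_of_isCP N h

/-- A completely positive map is positive. -/
theorem IsCP.posSemidef {A B : Type} {Φ : Superop A B} (h : IsCP Φ) {X : Matrix A A ℂ}
    (hX : X.PosSemidef) : (Φ X).PosSemidef :=
  (h Unit _ (hX.submatrix (fun p : Unit × A => p.2))).submatrix (fun b : B => ((), b))

open scoped Classical in
/-- The uniform state of a system with `k` levels majorizes every channel `N` with
`k N ≤ Tr[·] 1`. -/
theorem majorizes_of_isCP {A₀ B₀ A B : Type} [Fintype A₀] [DecidableEq A₀] [Fintype B₀]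
    [DecidableEq B₀] [Nonempty B₀] [Fintype A] [DecidableEq A] [Nonempty A] [Fintype B]
    [DecidableEq B] [Nonempty B] (hA₀ : Fintype.card A₀ = 1) (N : Channel A B)
    (h : IsCP (((1 / (Fintype.card B₀ : ℝ) : ℝ) : ℂ) • traceOne A B - N.1)) :
    Majorizes (uniformChannel A₀ B₀) N := by
  have hk : (0 : ℝ) < Fintype.card B₀ := by exact_mod_cast Fintype.card_pos
  have hle : Fintype.card B₀ ≤ Fintype.card B := by
    -- Comparing traces in `k N ≤ Tr[·] 1` gives `k ≤ |B|`.
    have := one_le_mul_card_of_isCP N h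
    rw [mul_one_div, one_le_div hk] at this
    exact_mod_cast this
  obtain ⟨f⟩ := Function.Embedding.nonempty_of_card_le hle
  obtain ⟨a₀, ha₀⟩ := Fintype.card_eq_one_iff.1 hA₀
  set k : ℝ := (Fintype.card B₀ : ℝ) with hkdef
  set n : ℝ := (Fintype.card B : ℝ) with hndef
  set P : B → ℝ := fun b => if b ∈ Set.range f then 1 else 0 with hP
  have hP0 : ∀ b, 0 ≤ P b := fun b => by simp only [hP]; split_ifs <;> norm_num
  have hP0' : ∀ b, 0 ≤ 1 - P b := fun b => by simp only [hP]; split_ifs <;> norm_num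
  have hPP : ∀ b, P b * P b = P b := fun b => by simp only [hP]; split_ifs <;> norm_num
  have hPsum : ∑ b, P b = k := by
    simp only [hP, Finset.sum_boole, hkdef]
    rw [← Finset.card_univ, ← Finset.card_map f]
    congr 2
    ext b
    simp
  have hP1 : ∑ b, (1 - P b) = n - k := by
    rw [Finset.sum_sub_distrib, hPsum]
    simp [hndef]
  have hnk : n - k = 0 → ∀ b, 1 - P b = 0 := fun h0 b =>
    (Finset.sum_eq_zero_iff_of_nonneg fun b _ => hP0' b).1 (hP1.trans h0) b (Finset.mem_univ b)
  have hN : ∀ X : Matrix A A ℂ, (X.trace • (1 : Matrix B B ℂ) - (k : ℂ) • N.1 X).trace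
      = ((n - k : ℝ) : ℂ) * X.trace := by
    intro X
    have := N.2.2 X
    simp only [Matrix.trace_sub, Matrix.trace_smul, this, Matrix.trace_one, smul_eq_mul, hndef]
    push_cast
    ring
  -- Measure the projection `P` on `B`, then apply `N` or its normalized complement to the stored
  -- input. If `n = k` the inverse is `0` by convention and the second branch disappears.
  set E : Superop (A × B) B := N.1 ∘ₗ weightedTrace A P
    + (((n - k)⁻¹ : ℝ) : ℂ) • ((traceOne A B - (k : ℂ) • N.1) ∘ₗ weightedTrace A fun b => 1 - P b)
    with hEdef
  have hEk : ∀ X Y, E (X ⊗ₖ Y) = (∑ b, (P b : ℂ) * Y b b) • N.1 X + (((n - k)⁻¹ : ℝ) : ℂ) •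
      (∑ b, ((1 - P b : ℝ) : ℂ) * Y b b) • (X.trace • (1 : Matrix B B ℂ) - (k : ℂ) • N.1 X) := by
    intro X Y
    simp only [hEdef, LinearMap.add_apply, LinearMap.smul_apply, LinearMap.comp_apply,
      weightedTrace_kronecker, map_smul, LinearMap.sub_apply, traceOne_apply]
  have hcp : IsCP (traceOne A B - (k : ℂ) • N.1) := by
    have e : traceOne A B - (k : ℂ) • N.1
        = (k : ℂ) • (((1 / k : ℝ) : ℂ) • traceOne A B - N.1) := by
      have hkc : (k : ℂ) ≠ 0 := by exact_mod_cast hk.ne'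
      rw [smul_sub, smul_smul, Complex.ofReal_div, Complex.ofReal_one, mul_one_div_cancel hkc,
        one_smul]
    rw [e]
    exact isCP_smul h hk.le
  have hE : IsCP E ∧ IsTP E := by
    refine ⟨isCP_add (isCP_comp N.2.1 (isCP_weightedTrace A hP0)) (isCP_smul
      (isCP_comp hcp (isCP_weightedTrace A hP0')) (inv_nonneg.2 (sub_nonneg.2 ?_))), fun X => ?_⟩
    · rw [hkdef, hndef]
      exact_mod_cast hle
    have h1 : (E X).trace = (weightedTrace A P X).trace + (((n - k)⁻¹ * (n - k) : ℝ) : ℂ) *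
        (weightedTrace A (fun b => 1 - P b) X).trace := by
      have := N.2.2 (weightedTrace A P X)
      simp only [hEdef, LinearMap.add_apply, LinearMap.smul_apply, LinearMap.comp_apply,
        LinearMap.sub_apply, traceOne_apply, Matrix.trace_add, Matrix.trace_smul, hN, this]
      push_cast
      simp [mul_assoc]
    have h2 : (weightedTrace A P X).trace + (weightedTrace A (fun b => 1 - P b) X).trace
        = X.trace := by
      simp [weightedTrace, Matrix.trace, Fintype.sum_prod_type, ← Finset.sum_add_distrib,
        ← add_mul]
    rw [h1, ← h2]
    by_cases h0 : n - k = 0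
    · have h3 : (weightedTrace A (fun b => 1 - P b) X).trace = 0 := by
        simp [weightedTrace, Matrix.trace, hnk h0]
      rw [h3, mul_zero]
    · rw [inv_mul_cancel₀ h0, Complex.ofReal_one, one_mul]
  have hu : IsConditionallyUnital E := by
    intro τ hτ
    have h1 : E (τ ⊗ₖ 1) = (k : ℂ) • N.1 τ + (((n - k)⁻¹ * (n - k) : ℝ) : ℂ) •
        ((1 : Matrix B B ℂ) - (k : ℂ) • N.1 τ) := by
      simp only [hEk, Matrix.one_apply_eq, mul_one, ← Complex.ofReal_sum, hPsum, hP1, hτ.2,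
        one_smul, smul_smul, Complex.ofReal_mul]
    rw [h1]
    -- When `n = k`, the positive operator `1 - k N(τ)` has trace zero, so `k N(τ) = 1` already.
    by_cases h0 : n - k = 0
    · have h2 := hN τ
      have h3 := hcp.posSemidef hτ.1
      rw [LinearMap.sub_apply, LinearMap.smul_apply, traceOne_apply] at h3
      rw [h0, Complex.ofReal_zero, zero_mul, h3.trace_eq_zero_iff, hτ.2, one_smul] at h2
      rw [h2, smul_zero, add_zero]
      exact (sub_eq_zero.1 h2).symm
    · rw [inv_mul_cancel₀ h0, Complex.ofReal_one, one_smul, add_sub_cancel]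
  have hV := isIsometry_embeddingMatrix (f := fun a : A => (a, a₀)) (by
    intro a a' haa
    simpa using haa)
  refine Or.inr ⟨hle, embeddingMatrix f, isIsometry_embeddingMatrix f.injective,
    supermap A (embeddingMatrix fun a : A => (a, a₀)) E, isMixing_supermap hA₀ hV hE hu, ?_⟩
  refine LinearMap.ext fun X => ?_
  -- The source emits the uniform state on the range of `f`, so the test `P` succeeds with certainty
  -- and `E` outputs `N X`.
  have e : lTensor A (conjBy (embeddingMatrix f) ∘ₗ (uniformChannel A₀ B₀).1)
      (conjBy (embeddingMatrix fun a : A => (a, a₀)) X)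
      = X ⊗ₖ Matrix.diagonal fun b => ((P b / k : ℝ) : ℂ) := by
    ext p q
    have e1 : (Matrix.of fun α α' => conjBy (embeddingMatrix fun a : A => (a, a₀)) X (p.1, α)
        (q.1, α')) = Matrix.of fun _ _ : A₀ => X p.1 q.1 := by
      ext α α'
      simp [conjBy, embeddingMatrix, Matrix.mul_apply, ha₀ α, ha₀ α', apply_ite]
    have e2 : (Matrix.of fun _ _ : A₀ => X p.1 q.1).trace = X p.1 q.1 := by
      simp [Matrix.trace, hA₀]
    change (conjBy (embeddingMatrix f)) ((uniformChannel A₀ B₀).1 (Matrix.of fun α α' =>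
      conjBy (embeddingMatrix fun a : A => (a, a₀)) X (p.1, α) (q.1, α'))) p.2 q.2 = _
    rw [e1]
    simp only [LinearMap.coe_mk, AddHom.coe_mk, uniformChannel, uniformSuperop, e2, map_smul,
      Matrix.smul_apply, Matrix.kroneckerMap_apply, conjBy, Matrix.mul_one,
      embeddingMatrix_mul_conjTranspose f.injective, Matrix.diagonal_apply, smul_eq_mul, hP]
    split_ifs <;> simp [hkdef, div_eq_mul_inv]
  change N.1 X = E (lTensor A _ _)
  have hkc : (k : ℂ) ≠ 0 := by exact_mod_cast hk.ne'
  have e1 : ∀ b, P b * (P b / k) = P b / k := fun b => by rw [mul_div_assoc', hPP]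
  have e2 : ∀ b, (1 - P b) * (P b / k) = 0 := fun b => by
    rw [mul_div_assoc', sub_mul, hPP, one_mul, sub_self, zero_div]
  rw [e, hEk]
  simp only [Matrix.diagonal_apply_eq, ← Complex.ofReal_mul, e1, e2, Complex.ofReal_zero,
    Finset.sum_const_zero, zero_smul, smul_zero, add_zero, ← Complex.ofReal_sum,
    ← Finset.sum_div, hPsum, div_self hk.ne', Complex.ofReal_one, one_smul]

/-! ### Uniform qubits, tensor powers and minimality -/

theorem tensor_uniformChannel (A B A' B' : Type) [Fintype A] [Fintype B] [DecidableEq B]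
    [Nonempty B] [Fintype A'] [Fintype B'] [DecidableEq B'] [Nonempty B'] :
    (uniformChannel A B).tensor (uniformChannel A' B') = uniformChannel (A × A') (B × B') := by
  refine Subtype.ext (LinearMap.ext fun X => ?_)
  ext p q
  simp [Channel.tensor, uniformChannel, uniformSuperop, tensor, lTensor, rTensor, Matrix.trace,
    Fintype.sum_prod_type, Matrix.one_apply, Prod.ext_iff, ite_and, div_eq_mul_inv,
    ← Finset.mul_sum, mul_assoc, mul_comm]

/-- A normalized channel entropy has the value `n` at some uniform state of dimension `2 ^ n`. -/
theorem exists_uniformChannel_eq {H : ChannelFunction} (hH : IsChannelEntropy H)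
    (hn : IsNormalized H) (n : ℕ) :
    ∃ (A B : Type) (_ : Fintype A) (_ : DecidableEq A) (_ : Nonempty A)
      (_ : Fintype B) (_ : DecidableEq B) (_ : Nonempty B), Fintype.card A = 1 ∧
        Fintype.card B = 2 ^ (n + 1) ∧ H A B (uniformChannel A B) = n + 1 := by
  induction n with
  -- The index `n` stands for `n + 1` qubits, so the base case is the normalization itself.
  | zero => exact ⟨Unit, Fin 2, inferInstance, inferInstance, inferInstance, inferInstance,
      inferInstance, inferInstance, by simp, by simp, by
        rw [IsNormalized] at hn
        simpa using hn⟩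
  | succ n ih =>
    obtain ⟨A, B, _, _, _, _, _, _, hA, hB, h⟩ := ih
    refine ⟨A × Unit, B × Fin 2, inferInstance, inferInstance, inferInstance, inferInstance,
      inferInstance, inferInstance, by simp [hA], by simp [hB, pow_succ], ?_⟩
    rw [← tensor_uniformChannel, hH.additive, h, hn]
    push_cast
    ring

/-- Tensor powers multiply additive functions. -/
theorem exists_tensor_power {H H' : ChannelFunction} (hH : IsChannelEntropy H)
    (hH' : IsChannelEntropy H') {A B : Type} [Fintype A] [DecidableEq A] [Nonempty A]
    [Fintype B] [DecidableEq B] [Nonempty B] (N : Channel A B) (n : ℕ) :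
    ∃ (A' B' : Type) (_ : Fintype A') (_ : DecidableEq A') (_ : Nonempty A')
      (_ : Fintype B') (_ : DecidableEq B') (_ : Nonempty B') (M : Channel A' B'),
        H A' B' M = (n + 1) * H A B N ∧ H' A' B' M = (n + 1) * H' A B N := by
  induction n with
  | zero => exact ⟨A, B, inferInstance, inferInstance, inferInstance, inferInstance,
      inferInstance, inferInstance, N, by simp, by simp⟩
  | succ n ih =>
    obtain ⟨A', B', _, _, _, _, _, _, M, h, h'⟩ := ih
    refine ⟨A' × A, B' × B, inferInstance, inferInstance, inferInstance, inferInstance,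
      inferInstance, inferInstance, M.tensor N, ?_, ?_⟩
    · rw [hH.additive, h]
      push_cast
      ring
    · rw [hH'.additive, h']
      push_cast
      ring

/-- The hypothesis says `2 ^ (n + 1) N ≤ Tr[·] 1`, so `n + 1` uniform qubits majorize `N`. -/
theorem natCast_le_of_le_channelMinEntropy {H : ChannelFunction} (hH : IsChannelEntropy H)
    (hn : IsNormalized H) {A B : Type} [Fintype A] [DecidableEq A] [Nonempty A]
    [Fintype B] [DecidableEq B] [Nonempty B] (N : Channel A B) (n : ℕ)
    (h : (n + 1 : ℝ) ≤ channelMinEntropy A B N) : (n + 1 : ℝ) ≤ H A B N := by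
  obtain ⟨A₀, B₀, _, _, _, _, _, _, hA, hB, h0⟩ := exists_uniformChannel_eq hH hn n
  rw [← h0]
  refine hH.monotone _ _ _ _ _ _ (majorizes_of_isCP hA N ?_)
  have e : (1 / (Fintype.card B₀ : ℝ) : ℝ) = 2 ^ (-(n + 1 : ℝ)) := by
    rw [hB, Real.rpow_neg two_pos.le, one_div]
    norm_cast
  rw [e]
  exact (le_channelMinEntropy_iff N _).1 h

theorem channelMinEntropy_le {H : ChannelFunction} (hH : IsChannelEntropy H)
    (hn : IsNormalized H) {A B : Type} [Fintype A] [DecidableEq A] [Nonempty A]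
    [Fintype B] [DecidableEq B] [Nonempty B] (N : Channel A B) :
    channelMinEntropy A B N ≤ H A B N := by
  have hm := isChannelEntropy_channelMinEntropy
  -- Rounding costs at most one bit for a whole tensor power, hence an arbitrarily small amount per
  -- copy.
  have key : ∀ n : ℕ, (n + 1) * (channelMinEntropy A B N - H A B N) ≤ 1 := by
    intro n
    obtain ⟨A₁, B₁, _, _, _, _, _, _, M, hM, hM'⟩ := exists_tensor_power hH hm N n
    -- `H_min` may be negative: `j + 1` uniform qubits raise both entropies by `j + 1`, so that the
    -- natural-number floor applies.
    obtain ⟨j, hj⟩ := exists_nat_ge (-((n + 1) * channelMinEntropy A B N))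
    obtain ⟨A₀, B₀, _, _, _, _, _, _, -, hB, h0⟩ := exists_uniformChannel_eq hH hn j
    have h1 : channelMinEntropy (A₁ × A₀) (B₁ × B₀) (M.tensor (uniformChannel A₀ B₀))
        = (n + 1) * channelMinEntropy A B N + (j + 1) := by
      rw [hm.additive, hM', channelMinEntropy_uniformChannel, hB]
      rw [Nat.cast_pow, Nat.cast_ofNat, Real.logb_pow, Real.logb_self_eq_one one_lt_two, mul_one,
        Nat.cast_succ]
    have h2 : H (A₁ × A₀) (B₁ × B₀) (M.tensor (uniformChannel A₀ B₀))
        = (n + 1) * H A B N + (j + 1) := by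
      rw [hH.additive, hM, h0]
    have h3 : 0 ≤ (n + 1) * channelMinEntropy A B N + j := by linarith
    have h4 := natCast_le_of_le_channelMinEntropy hH hn (M.tensor (uniformChannel A₀ B₀))
      ⌊(n + 1) * channelMinEntropy A B N + j⌋₊ (by
        rw [h1]
        linarith [Nat.floor_le h3])
    rw [h2] at h4
    linarith [Nat.lt_floor_add_one ((n + 1) * channelMinEntropy A B N + (j : ℝ))]
  by_contra! hlt
  obtain ⟨n, hn'⟩ := exists_nat_gt (1 / (channelMinEntropy A B N - H A B N))
  rw [div_lt_iff₀ (sub_pos.2 hlt)] at hn'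
  linarith [key n]

end QChannel

end

theorem theorem18 :
    (QChannel.IsChannelEntropy QChannel.channelMinEntropy ∧
      QChannel.IsNormalized QChannel.channelMinEntropy) ∧
    ∀ H : QChannel.ChannelFunction, QChannel.IsChannelEntropy H → QChannel.IsNormalized H →
      ∀ (A B : Type) [Fintype A] [DecidableEq A] [Nonempty A]
        [Fintype B] [DecidableEq B] [Nonempty B] (N : QChannel.Channel A B),
        QChannel.channelMinEntropy A B N ≤ H A B N :=
  ⟨⟨QChannel.isChannelEntropy_channelMinEntropy, QChannel.isNormalized_channelMinEntropy⟩,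
    fun _ hH hn _ _ _ _ _ _ _ _ N => QChannel.channelMinEntropy_le hH hn N⟩
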